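/- Let $\kappa\in(0,1)$ and $\lambda=\sqrt{1-\kappa^2}$. Put $$f(T)=\int_0^T {}_2F_1\left(\tfrac14,\tfrac34;\tfrac12;\kappa^2\sin^2 t\right)dt$$ for complex $T$ near $0$. On a sufficiently small open disc $D$ about $0$ there are analytic functions $\varphi$ and $\psi$ such that $\varphi$ is the local inverse of $f$ at $0$ (with $\varphi(0)=0$ and $f(\varphi(z))=z$ on $D$), $\psi(0)=0$ and $\sin\psi=\kappa\sin\varphi$ on $D$; put $\mathrm{dn}_2=\cos\psi$ on any such disc $D$. There is a lattice in $\mathbb C$ whose Weierstrass function $\wp$ has invariants $$g_2=\tfrac43-\kappa^2=\lambda^2+\tfrac13,\qquad g_3=\tfrac8{27}-\tfrac13\kappa^2=\tfrac13\lambda^2-\tfrac1{27}.$$ For the Weierstrass function $\wp$ of any lattice $\Lambda$ with these invariants, $$(1-\mathrm{dn}_2)\left(\tfrac13+\wp\right)=\tfrac12\kappa^2\quad\text{on } D\setminus\Lambda .$$ Hence $\mathrm{dn}_2$ extends globally to an elliptic function: there is a meromorphic function $g$ on $\mathbb C$, with every element of $\Lambda$ as a period, that coincides with $\mathrm{dn}_2$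 on every such disc $D$ and satisfies $(1-g(z))\left(\tfrac13+\wp(z)\right)=\tfrac12\kappa^2$ for all $z\in\mathbb C\setminus\Lambda$ with $\wp(z)\ne-\tfrac13$. -/

import Mathlib

noncomputable section

/-- The complementary modulus `λ = √(1 - κ²)`. -/
def complementaryModulus (κ : ℝ) : ℝ := √(1 - κ ^ 2)

/-- The function `f(T) = ∫₀ᵀ F(1/4, 3/4; 1/2; κ² sin² t) dt` of a complex variable `T`; the integral
is taken along the straight segment `t = s T`, `0 ≤ s ≤ 1`. -/
def sigFourIntegral (κ : ℝ) (T : ℂ) : ℂ :=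
  ∫ s in (0 : ℝ)..1,
    T * ordinaryHypergeometric (1 / 4 : ℂ) (3 / 4 : ℂ) (1 / 2 : ℂ)
      ((κ : ℂ) ^ 2 * Complex.sin ((s : ℂ) * T) ^ 2)

/-- The data in the local construction of `dn₂` on the open disc `D` of radius `r` about `0`:
`φ` is analytic in `D` and is the local inverse of `f` at `0`, and `ψ` is analytic in `D` with
`ψ 0 = 0` and `sin ψ = κ sin φ`. -/
structure IsDnTwoData (κ r : ℝ) (φ ψ : ℂ → ℂ) : Prop where
  radius_pos : 0 < r
  analytic_phi : AnalyticOnNhd ℂ φ (Metric.ball 0 r)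
  phi_zero : φ 0 = 0
  right_inv : ∀ z ∈ Metric.ball (0 : ℂ) r, sigFourIntegral κ (φ z) = z
  left_inv : ∀ᶠ T in nhds (0 : ℂ), φ (sigFourIntegral κ T) = T
  analytic_psi : AnalyticOnNhd ℂ ψ (Metric.ball 0 r)
  psi_zero : ψ 0 = 0
  sin_psi : ∀ z ∈ Metric.ball (0 : ℂ) r, Complex.sin (ψ z) = κ * Complex.sin (φ z)

/-- The function `dn₂ = cos ψ`, as initially defined in the disc. -/
def dnTwo (ψ : ℂ → ℂ) (z : ℂ) : ℂ := Complex.cos (ψ z)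

/-- The Weierstrass function of the period lattice `L` has the invariants
`g₂ = λ² + 1/3` and `g₃ = λ²/3 - 1/27`. -/
def HasDnTwoInvariants (κ : ℝ) (L : PeriodPair) : Prop :=
  L.g₂ = (complementaryModulus κ : ℂ) ^ 2 + 1 / 3 ∧
    L.g₃ = (complementaryModulus κ : ℂ) ^ 2 / 3 - 1 / 27

/-- `g` is an elliptic function with respect to the lattice of `L`: it is meromorphic on `ℂ`
(with no removable singularities; at a pole it takes the conventional value `0`) and every element
of the lattice is a period. -/
def IsEllipticFor (L : PeriodPair) (g : ℂ → ℂ) : Prop :=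
  MeromorphicNFOn g Set.univ ∧ ∀ w ∈ L.lattice, Function.Periodic g w

end

/-! The hypergeometric function is algebraic here: at `y ^ 2` it is the even part of the binomial
series of `(1 + y)^(-1/2)`. With `y = sin ψ` this becomes `2 F² cos² ψ = 1 + cos ψ`. Combined with
`F φ' = 1` and `cos ψ ψ' = κ cos φ φ'`, it shows that `v = 2 (1 - dn₂) / κ²` satisfies `v'² = 4v -
4v² + κ² v³`. The invariants are chosen so that `1 / (1/3 + ℘)` satisfies the same equation. Both
functions vanish at `0` without vanishing identically, which forces them to agree near `0`
(`AnalyticAt.eventuallyEq_of_deriv_sq`). The identity theorem carries this over the disc, and `1 -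
(κ²/2) / (1/3 + ℘)` is the global extension.

The lattice is found on the imaginary axis of `τ`: `g₂³ / g₃²` is compared with its target at `q =
0` and at `τ = i`, and the intermediate value theorem followed by a rescaling gives
`PeriodPair.exists_g₂_g₃_eq`. -/

/-! ### The hypergeometric function in closed form -/

theorem ringChoose_neg_half_two_mul (n : ℕ) :
    Ring.choose (-(1 / 2) : ℂ) (2 * n) =
      ordinaryHypergeometricCoefficient (1 / 4 : ℂ) (3 / 4) (1 / 2) n := by
  have step (m : ℕ) : ((m : ℂ) + 1) * Ring.choose (-(1 / 2) : ℂ) (m + 1) =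
      (-(1 / 2) - m) * Ring.choose (-(1 / 2) : ℂ) m := by
    simp only [Ring.choose_eq_smul, Nat.factorial_succ, descPochhammer_succ_right,
      Polynomial.smeval_mul, Polynomial.smeval_sub, Polynomial.smeval_X, Polynomial.smeval_natCast]
    have := Nat.cast_add_one_ne_zero (R := ℂ) m
    have := Nat.cast_ne_zero (R := ℂ).2 m.factorial_ne_zero
    simp
    field_simp
  have half_ne (m : ℕ) : (ascPochhammer ℂ m).eval (1 / 2) ≠ 0 := by
    rw [Ne, ascPochhammer_eval_eq_zero_iff]
    rintro ⟨k, -, hk⟩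
    have : (2 * k + 1 : ℂ) = 0 := by linear_combination 2 * hk
    norm_cast at this
  induction n with
  | zero => simp [ordinaryHypergeometricCoefficient]
  | succ n ih =>
    have h1 := step (2 * n)
    have h2 := step (2 * n + 1)
    rw [ih] at h1
    have hn := half_ne n
    have hn' := half_ne (n + 1)
    have e1 : (2 * n + 1 : ℂ) ≠ 0 := by norm_cast
    have e2 : (2 * n + 2 : ℂ) ≠ 0 := by norm_cast
    have e3 := Nat.cast_ne_zero (R := ℂ).2 n.factorial_ne_zero
    have e4 : (n + 1 : ℂ) ≠ 0 := by norm_cast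
    have e5 : (n : ℂ) + 1 / 2 ≠ 0 := fun h ↦ e1 (by linear_combination 2 * h)
    push_cast at h1 h2
    rw [show 2 * (n + 1) = 2 * n + 1 + 1 by ring]
    -- Two binomial recursion steps make one hypergeometric step, since `(2n + 1/2)(2n + 3/2) = 4 (n
    -- + 1/4)(n + 3/4)` and `(2n + 1)(2n + 2) = 4 (n + 1/2)(n + 1)`.
    have h3 : (2 * n + 2 : ℂ) * (2 * n + 1) * Ring.choose (-(1 / 2) : ℂ) (2 * n + 1 + 1) =
        (2 * n + 3 / 2) * (2 * n + 1 / 2) *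
          ordinaryHypergeometricCoefficient (1 / 4 : ℂ) (3 / 4) (1 / 2) n := by
      linear_combination (2 * n + 1 : ℂ) * h2 - (2 * n + 3 / 2 : ℂ) * h1
    refine mul_left_cancel₀ (mul_ne_zero e2 e1) (h3.trans ?_)
    simp only [ordinaryHypergeometricCoefficient, ascPochhammer_succ_eval, Nat.factorial_succ,
      mul_inv, Nat.cast_mul, Nat.cast_add, Nat.cast_one]
    rw [add_comm (1 / 2 : ℂ) (n : ℂ)]
    have e6 : (2 * n + 2 : ℂ) * ((n : ℂ) + 1)⁻¹ = 2 := by field_simp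
    have e7 : (2 * n + 1 : ℂ) * ((n : ℂ) + 1 / 2)⁻¹ = 2 := by
      rw [← div_eq_mul_inv, div_eq_iff e5]; ring
    linear_combination (-((n.factorial : ℂ)⁻¹ * (ascPochhammer ℂ n).eval (1 / 4) *
      (ascPochhammer ℂ n).eval (3 / 4) * ((ascPochhammer ℂ n).eval (1 / 2))⁻¹) * (1 / 4 + n) *
      (3 / 4 + n)) * (2 * e7 + (2 * n + 1 : ℂ) * ((n : ℂ) + 1 / 2)⁻¹ * e6)

/-- Averaging the binomial series at `y` and `-y` cancels the odd terms. -/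
theorem ordinaryHypergeometric_quarter_sq {y : ℂ} (hy : ‖y‖ < 1) :
    ordinaryHypergeometric (1 / 4 : ℂ) (3 / 4 : ℂ) (1 / 2 : ℂ) (y ^ 2) =
      ((1 + y) ^ (-(1 / 2) : ℂ) + (1 - y) ^ (-(1 / 2) : ℂ)) / 2 := by
  have key {w : ℂ} (hw : ‖w‖ < 1) :
      HasSum (fun n ↦ Ring.choose (-(1 / 2) : ℂ) n * w ^ n) ((1 + w) ^ (-(1 / 2) : ℂ)) := by
    have := (Complex.one_add_cpow_hasFPowerSeriesOnBall_zero (a := -(1 / 2))).hasSum (y := w)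
      (by simpa [enorm_eq_nnnorm, ← NNReal.coe_lt_coe] using hw)
    simpa [binomialSeries, mul_comm, FormalMultilinearSeries.coeff_ofScalars] using this
  have h1 := ((key hy).add (key (w := -y) (by simpa))).div_const 2
  rw [← sub_eq_add_neg] at h1
  have h2 : Function.Injective (fun n : ℕ ↦ 2 * n) := fun a b h ↦ by simpa using h
  rw [← h2.hasSum_iff] at h1
  · rw [ordinaryHypergeometric_eq_tsum, ← h1.tsum_eq]
    refine tsum_congr fun n ↦ ?_
    simp only [Function.comp, ringChoose_neg_half_two_mul, smul_eq_mul, pow_mul, neg_sq]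
    ring
  · intro n hn
    have : Odd n := by
      rw [← Nat.not_even_iff_odd]
      rintro ⟨k, rfl⟩
      exact hn ⟨k, by ring⟩
    rw [this.neg_pow]
    ring

theorem norm_sin_lt_one_near_zero : ∀ᶠ z : ℂ in nhds 0, ‖Complex.sin z‖ < 1 :=
  (Complex.continuous_sin.norm.tendsto 0).eventually_lt_const (by simp)

/-- `2F² cos² ψ = 1 + cos ψ` for `F = ₂F₁(1/4, 3/4; 1/2; sin² ψ)` and small `ψ`. -/
theorem ordinaryHypergeometric_quarter_sin_sq : ∀ᶠ z : ℂ in nhds 0,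
    2 * ordinaryHypergeometric (1 / 4 : ℂ) (3 / 4 : ℂ) (1 / 2 : ℂ) (Complex.sin z ^ 2) ^ 2 *
      Complex.cos z ^ 2 = 1 + Complex.cos z := by
  -- This product squares to `1`; continuity and its value `1` at `0` select the sign.
  have hc : ContinuousAt (fun z : ℂ ↦ (1 + Complex.sin z) ^ (-(1 / 2) : ℂ) *
      (1 - Complex.sin z) ^ (-(1 / 2) : ℂ) * Complex.cos z) 0 := by
    refine ((ContinuousAt.cpow (by fun_prop) (by fun_prop) ?_).mul
      (ContinuousAt.cpow (by fun_prop) (by fun_prop) ?_)).mul (by fun_prop) <;> simp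
  filter_upwards [norm_sin_lt_one_near_zero,
    hc.eventually_ne (show _ ≠ (-1 : ℂ) by norm_num)] with z hz hz'
  rw [ordinaryHypergeometric_quarter_sq hz]
  have ha : 1 + Complex.sin z ≠ 0 := fun h ↦ by
    simp [show Complex.sin z = -1 by linear_combination h] at hz
  have hb : 1 - Complex.sin z ≠ 0 := fun h ↦ by
    simp [show Complex.sin z = 1 by linear_combination -h] at hz
  have hsq {x : ℂ} (hx : x ≠ 0) : (x ^ (-(1 / 2) : ℂ)) ^ 2 * x = 1 := by
    rw [sq, ← Complex.cpow_add _ _ hx, show (-(1 / 2) : ℂ) + -(1 / 2) = -1 by norm_num,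
      Complex.cpow_neg_one, inv_mul_cancel₀ hx]
  have hA := hsq ha
  have hB := hsq hb
  have hcos := Complex.sin_sq_add_cos_sq z
  generalize (1 + Complex.sin z) ^ (-(1 / 2) : ℂ) = A at *
  generalize (1 - Complex.sin z) ^ (-(1 / 2) : ℂ) = B at *
  have hAB : A * B * Complex.cos z = 1 := by
    refine (mul_self_eq_one_iff.1 ?_).resolve_right hz'
    linear_combination A ^ 2 * B ^ 2 * hcos + B ^ 2 * (1 - Complex.sin z) * hA + hB
  linear_combination (A ^ 2 + B ^ 2) / 2 * hcos + (1 - Complex.sin z) / 2 * hA +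
    (1 + Complex.sin z) / 2 * hB + Complex.cos z * hAB

/-! ### The local construction of `φ` and `ψ` -/

theorem AnalyticAt.exists_analyticAt_inverse {f : ℂ → ℂ} (hf : AnalyticAt ℂ f 0) (h0 : f 0 = 0)
    (hd : deriv f 0 ≠ 0) : ∃ g : ℂ → ℂ, AnalyticAt ℂ g 0 ∧ g 0 = 0 ∧
      (∀ᶠ z in nhds 0, f (g z) = z) ∧ ∀ᶠ z in nhds 0, g (f z) = z := by
  have hs : HasStrictDerivAt f (deriv f 0) 0 := hf.hasStrictDerivAt
  refine ⟨hs.localInverse f _ 0 hd, ?_, ?_, ?_, hs.eventually_left_inverse hd⟩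
  · simpa [h0] using hf.analyticAt_localInverse hd
  · simpa [h0] using (hs.eventually_left_inverse hd).self_of_nhds
  · simpa [h0] using hs.eventually_right_inverse hd

theorem analyticAt_ordinaryHypergeometric_quarter : AnalyticAt ℂ
    (ordinaryHypergeometric (1 / 4 : ℂ) (3 / 4 : ℂ) (1 / 2 : ℂ) : ℂ → ℂ) 0 := by
  have hr : 0 < (ordinaryHypergeometricSeries ℂ (1 / 4 : ℂ) (3 / 4 : ℂ) (1 / 2 : ℂ)).radius := by
    rw [ordinaryHypergeometricSeries_radius_eq_one]
    · simp
    · refine fun k ↦ ⟨fun h ↦ ?_, fun h ↦ ?_, fun h ↦ ?_⟩ <;>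
      · have := congrArg Complex.re h
        norm_num at this
        have : (0 : ℝ) ≤ k := Nat.cast_nonneg k
        linarith
  exact (FormalMultilinearSeries.hasFPowerSeriesOnBall _ hr).analyticAt

theorem analyticAt_sigFourIntegrand (κ : ℝ) : AnalyticAt ℂ
    (fun t : ℂ ↦ ordinaryHypergeometric (1 / 4 : ℂ) (3 / 4 : ℂ) (1 / 2 : ℂ)
      ((κ : ℂ) ^ 2 * Complex.sin t ^ 2)) 0 := by
  refine AnalyticAt.fun_comp (g := ordinaryHypergeometric (1 / 4 : ℂ) (3 / 4 : ℂ) (1 / 2 : ℂ)) ?_ ?_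
  · simpa using analyticAt_ordinaryHypergeometric_quarter
  · fun_prop

theorem sigFourIntegral_zero (κ : ℝ) : sigFourIntegral κ 0 = 0 := by
  simp [sigFourIntegral]

/-- On a small disc the integrand has a primitive `H`, and the integral along the segment is `H T -
H 0`. -/
theorem hasDerivAt_sigFourIntegral (κ : ℝ) : ∀ᶠ T in nhds (0 : ℂ),
    HasDerivAt (sigFourIntegral κ) (ordinaryHypergeometric (1 / 4 : ℂ) (3 / 4 : ℂ) (1 / 2 : ℂ)
      ((κ : ℂ) ^ 2 * Complex.sin T ^ 2)) T := by
  have ha := analyticAt_sigFourIntegrand κ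
  unfold sigFourIntegral
  set h : ℂ → ℂ := fun t ↦ ordinaryHypergeometric (1 / 4 : ℂ) (3 / 4 : ℂ) (1 / 2 : ℂ)
    ((κ : ℂ) ^ 2 * Complex.sin t ^ 2) with hh
  obtain ⟨r, hr, hball⟩ := Metric.eventually_nhds_iff_ball.1 ha.eventually_analyticAt
  have hd : DifferentiableOn ℂ h (Metric.ball 0 r) :=
    fun z hz ↦ (hball z hz).differentiableAt.differentiableWithinAt
  obtain ⟨H, hH⟩ := hd.isExactOn_ball
  have heq : ∀ T ∈ Metric.ball (0 : ℂ) r, ∫ s in (0 : ℝ)..1, T * h ((s : ℂ) * T) = H T - H 0 := by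
    intro T hT
    have hmem : ∀ s ∈ Set.uIcc (0 : ℝ) 1, (s : ℂ) * T ∈ Metric.ball (0 : ℂ) r := by
      intro s hs
      rw [Set.uIcc_of_le zero_le_one] at hs
      rw [mem_ball_zero_iff] at hT ⊢
      rw [norm_mul, Complex.norm_real, Real.norm_of_nonneg hs.1]
      exact (mul_le_of_le_one_left (norm_nonneg _) hs.2).trans_lt hT
    have := intervalIntegral.integral_eq_sub_of_hasDerivAt (a := 0) (b := 1)
      (f := fun s : ℝ ↦ H (s * T)) (f' := fun s : ℝ ↦ T * h (s * T)) ?_ ?_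
    · simpa using this
    · intro s hs
      have h1 : HasDerivAt (fun s : ℝ ↦ (s : ℂ) * T) T s := by
        simpa using (Complex.ofRealCLM.hasDerivAt (x := s)).mul_const T
      exact ((hH _ (hmem s hs)).comp_of_eq s h1 rfl).congr_deriv (mul_comm _ _)
    · refine ContinuousOn.intervalIntegrable ?_
      exact continuousOn_const.mul (hd.continuousOn.comp (by fun_prop) hmem)
  filter_upwards [Metric.ball_mem_nhds (0 : ℂ) hr] with T hT
  refine ((hH T hT).sub_const (H 0)).congr_of_eventuallyEq ?_
  filter_upwards [Metric.isOpen_ball.mem_nhds hT] with w hw using heq w hw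

theorem analyticAt_sigFourIntegral (κ : ℝ) : AnalyticAt ℂ (sigFourIntegral κ) 0 :=
  Complex.analyticAt_iff_eventually_differentiableAt.2
    ((hasDerivAt_sigFourIntegral κ).mono fun _ h ↦ h.differentiableAt)

theorem exists_isDnTwoData (κ : ℝ) : ∃ (r : ℝ) (φ ψ : ℂ → ℂ), IsDnTwoData κ r φ ψ := by
  obtain ⟨φ, hφ, hφ0, hr, hl⟩ := (analyticAt_sigFourIntegral κ).exists_analyticAt_inverse
    (sigFourIntegral_zero κ) (by rw [(hasDerivAt_sigFourIntegral κ).self_of_nhds.deriv]; simp)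
  obtain ⟨g, hg, hg0, hs, -⟩ := Complex.analyticAt_sin.exists_analyticAt_inverse
    Complex.sin_zero (by simp)
  have hin : AnalyticAt ℂ (fun z ↦ (κ : ℂ) * Complex.sin (φ z)) 0 := by fun_prop
  have hψ : AnalyticAt ℂ (fun z ↦ g (κ * Complex.sin (φ z))) 0 :=
    AnalyticAt.fun_comp (by simpa [hφ0] using hg) hin
  have hs' : ∀ᶠ z in nhds 0, Complex.sin (g (κ * Complex.sin (φ z))) = κ * Complex.sin (φ z) :=
    hin.continuousAt.eventually (by simpa [hφ0] using hs)
  obtain ⟨r, hr0, hball⟩ := Metric.eventually_nhds_iff_ball.1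
    (hφ.eventually_analyticAt.and (hr.and (hψ.eventually_analyticAt.and hs')))
  exact ⟨r, φ, fun z ↦ g (κ * Complex.sin (φ z)),
    { radius_pos := hr0
      analytic_phi := fun z hz ↦ (hball z hz).1
      phi_zero := hφ0
      right_inv := fun z hz ↦ (hball z hz).2.1
      left_inv := hl
      analytic_psi := fun z hz ↦ (hball z hz).2.2.1
      psi_zero := by simp [hφ0, hg0]
      sin_psi := fun z hz ↦ (hball z hz).2.2.2 }⟩

/-! ### Uniqueness for the differential equation -/

section

open Filter Topology

/-- If `e` had finite order `a` at `x`, then `e''` would have order `a - 2`, while `e * h` has order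
at least `a`. -/
theorem AnalyticAt.eventuallyEq_zero_of_deriv_deriv_eq_mul {e h : ℂ → ℂ} {x : ℂ}
    (he : AnalyticAt ℂ e x) (hh : AnalyticAt ℂ h x) (he0 : e x = 0) (he1 : deriv e x = 0)
    (hode : deriv (deriv e) =ᶠ[𝓝 x] e * h) : e =ᶠ[𝓝 x] 0 := by
  have h1 := he.analyticOrderAt_deriv_add_one
  have h2 := he.deriv.analyticOrderAt_deriv_add_one
  simp only [he0, he1, sub_zero] at h1 h2
  rw [analyticOrderAt_congr hode, analyticOrderAt_mul he hh] at h2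
  suffices analyticOrderAt e x = ⊤ from analyticOrderAt_eq_top.1 this
  rw [← h2] at h1
  generalize analyticOrderAt e x = a at *
  generalize analyticOrderAt h x = b at *
  cases a with
  | top => rfl
  | coe a =>
    cases b with
    | top => simp at h1
    | coe b =>
      norm_cast at h1
      omega

/-- Solutions of `v'² = 4v - 4v² + c v³` are solutions of `v'' = 2 - 4v + (3/2) c v²`. -/
theorem AnalyticAt.deriv_deriv_of_deriv_sq {v : ℂ → ℂ} {c x : ℂ} (hv : AnalyticAt ℂ v x)
    (hv0 : v x = 0) (hne : ¬ v =ᶠ[𝓝 x] 0)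
    (hode : ∀ᶠ z in 𝓝[≠] x, deriv v z ^ 2 = 4 * v z - 4 * v z ^ 2 + c * v z ^ 3) :
    deriv v x = 0 ∧ deriv (deriv v) =ᶠ[𝓝 x] fun z ↦ 2 - 4 * v z + 3 / 2 * c * v z ^ 2 := by
  have hv' := hv.deriv
  have hv'' := hv'.deriv
  have hode' : (fun z ↦ deriv v z ^ 2) =ᶠ[𝓝 x] fun z ↦ 4 * v z - 4 * v z ^ 2 + c * v z ^ 3 := by
    refine (AnalyticAt.frequently_eq_iff_eventually_eq (by fun_prop) (by fun_prop)).1 ?_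
    exact hode.frequently
  have hx := hode'.self_of_nhds
  refine ⟨by simpa [hv0] using hx, ?_⟩
  have hprod : deriv v * (fun z ↦ deriv (deriv v) z - (2 - 4 * v z + 3 / 2 * c * v z ^ 2))
      =ᶠ[𝓝 x] 0 := by
    filter_upwards [hode'.deriv, hv.eventually_analyticAt] with z hz hza
    have h1 := hza.differentiableAt.hasDerivAt
    have h2 := hza.deriv.differentiableAt.hasDerivAt
    rw [(h2.fun_pow 2).deriv, (((h1.const_mul 4).fun_sub ((h1.fun_pow 2).const_mul 4)).fun_add
      ((h1.fun_pow 3).const_mul c)).deriv] at hz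
    simp only [Pi.mul_apply, Pi.zero_apply]
    push_cast at hz
    linear_combination hz / 2
  -- One factor must vanish identically; it is not `v'`, as `v` would then be constantly `0`.
  have hord := analyticOrderAt_eq_top.2 hprod
  rw [analyticOrderAt_mul hv' (by fun_prop), ENat.add_eq_top] at hord
  rcases hord with hord | hord
  · have h1 := hv.analyticOrderAt_deriv_add_one
    simp only [hv0, sub_zero, hord, top_add] at h1
    exact absurd (analyticOrderAt_eq_top.1 h1.symm) hne
  · filter_upwards [analyticOrderAt_eq_top.1 hord] with z hz using sub_eq_zero.1 hz

/-- The first-order equation also has the zero solution, so uniqueness comes from the differentiated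
one: as `v² - w² = (v - w)(v + w)`, the difference satisfies a linear equation with zero initial
data. -/
theorem AnalyticAt.eventuallyEq_of_deriv_sq {v w : ℂ → ℂ} {c x : ℂ}
    (hv : AnalyticAt ℂ v x) (hv0 : v x = 0) (hvne : ¬ v =ᶠ[𝓝 x] 0)
    (hvode : ∀ᶠ z in 𝓝[≠] x, deriv v z ^ 2 = 4 * v z - 4 * v z ^ 2 + c * v z ^ 3)
    (hw : AnalyticAt ℂ w x) (hw0 : w x = 0) (hwne : ¬ w =ᶠ[𝓝 x] 0)
    (hwode : ∀ᶠ z in 𝓝[≠] x, deriv w z ^ 2 = 4 * w z - 4 * w z ^ 2 + c * w z ^ 3) :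
    v =ᶠ[𝓝 x] w := by
  obtain ⟨hv1, hv2⟩ := hv.deriv_deriv_of_deriv_sq hv0 hvne hvode
  obtain ⟨hw1, hw2⟩ := hw.deriv_deriv_of_deriv_sq hw0 hwne hwode
  have hd : deriv (v - w) =ᶠ[𝓝 x] deriv v - deriv w := by
    filter_upwards [hv.eventually_analyticAt, hw.eventually_analyticAt] with z h1 h2
    exact deriv_sub h1.differentiableAt h2.differentiableAt
  have key : v - w =ᶠ[𝓝 x] 0 := by
    refine (hv.sub hw).eventuallyEq_zero_of_deriv_deriv_eq_mul
      (h := fun z ↦ -4 + 3 / 2 * c * (v z + w z)) (by fun_prop) (by simp [hv0, hw0])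
      (by simp [hd.self_of_nhds, hv1, hw1]) ?_
    filter_upwards [hd.deriv, hv2, hw2, hv.eventually_analyticAt, hw.eventually_analyticAt]
      with z h h1 h2 h3 h4
    rw [h, deriv_sub h3.deriv.differentiableAt h4.deriv.differentiableAt, h1, h2]
    simp only [Pi.mul_apply, Pi.sub_apply]
    ring
  filter_upwards [key] with z hz using sub_eq_zero.1 hz

end

/-! ### Comparison of `dn₂` with `℘` -/

section

open Filter Topology

theorem PeriodPair.eventually_notMem_lattice (L : PeriodPair) (x : ℂ) :
    ∀ᶠ z in 𝓝[≠] x, z ∉ L.lattice := by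
  filter_upwards [nhdsWithin_le_nhds (L.compl_lattice_sdiff_singleton_mem_nhds x),
    self_mem_nhdsWithin] with z hz hzx hzL using hz ⟨hzL, hzx⟩

theorem PeriodPair.hasDerivAt_weierstrassP (L : PeriodPair) {z : ℂ} (hz : z ∉ L.lattice) :
    HasDerivAt L.weierstrassP (L.derivWeierstrassP z) z := by
  rw [← L.deriv_weierstrassP]
  exact (L.analyticOnNhd_weierstrassP z hz).differentiableAt.hasDerivAt

/-- The reciprocal of `1/3 + ℘` extends analytically to `0` and solves the differential equation
`v'² = 4v - 4v² + κ² v³`. -/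
theorem HasDnTwoInvariants.exists_analyticAt_inv {κ : ℝ} {L : PeriodPair} (hκ : κ ^ 2 ≤ 1)
    (hL : HasDnTwoInvariants κ L) : ∃ v : ℂ → ℂ, AnalyticAt ℂ v 0 ∧ v 0 = 0 ∧
      (∀ᶠ z in 𝓝[≠] 0, v z * (1 / 3 + L.weierstrassP z) = 1) ∧
      ∀ᶠ z in 𝓝[≠] 0, deriv v z ^ 2 = 4 * v z - 4 * v z ^ 2 + (κ : ℂ) ^ 2 * v z ^ 3 := by
  have hl : (complementaryModulus κ : ℂ) ^ 2 = 1 - (κ : ℂ) ^ 2 := by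
    exact_mod_cast congrArg Complex.ofReal (Real.sq_sqrt (show 0 ≤ 1 - κ ^ 2 by linarith))
  have hP := L.analyticAt_weierstrassPExcept 0
  have hden : AnalyticAt ℂ (fun z ↦ 1 + z ^ 2 * (1 / 3 + L.weierstrassPExcept 0 z)) 0 := by
    fun_prop
  have hden0 : ∀ᶠ z in 𝓝 (0 : ℂ), 1 + z ^ 2 * (1 / 3 + L.weierstrassPExcept 0 z) ≠ 0 :=
    hden.continuousAt.eventually_ne (by simp)
  set v : ℂ → ℂ := fun z ↦ z ^ 2 / (1 + z ^ 2 * (1 / 3 + L.weierstrassPExcept 0 z)) with hv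
  have hmul : ∀ᶠ z in 𝓝[≠] (0 : ℂ), v z * (1 / 3 + L.weierstrassP z) = 1 := by
    filter_upwards [nhdsWithin_le_nhds hden0, self_mem_nhdsWithin] with z hz hz0
    have hz0' : z ≠ 0 := hz0
    -- The term of the lattice point `0` is `1 / z² - 1 / 0²`, and `1 / 0² = 0` by convention.
    have h := L.weierstrassPExcept_add 0 z
    simp only [ZeroMemClass.coe_zero, sub_zero, one_div, ne_eq, OfNat.ofNat_ne_zero,
      not_false_eq_true, zero_pow, inv_zero] at h
    rw [hv, ← h]
    simp only []
    rw [div_mul_eq_mul_div, div_eq_one_iff_eq hz]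
    field_simp
    ring
  refine ⟨v, by fun_prop (disch := simp), by simp [hv], hmul, ?_⟩
  filter_upwards [hmul, eventually_eventually_nhdsWithin.2 hmul, L.eventually_notMem_lattice 0,
    self_mem_nhdsWithin] with z h1 h2 hzL hz0
  have hu : 1 / 3 + L.weierstrassP z ≠ 0 := right_ne_zero_of_mul_eq_one h1
  rw [isOpen_compl_singleton.nhdsWithin_eq hz0] at h2
  have heq : v =ᶠ[𝓝 z] fun w ↦ (1 / 3 + L.weierstrassP w)⁻¹ := by
    filter_upwards [h2] with w hw using eq_inv_of_mul_eq_one_left hw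
  have hd := ((L.hasDerivAt_weierstrassP hzL).const_add (1 / 3)).fun_inv hu
  have hsq := L.derivWeierstrassP_sq z hzL
  rw [hL.1, hL.2, hl] at hsq
  have hvz : v z = (1 / 3 + L.weierstrassP z)⁻¹ := heq.self_of_nhds
  rw [heq.deriv_eq, hd.deriv, hvz, div_pow, neg_sq, hsq]
  -- In `u = ℘ + 1/3` the cubic `4℘³ - g₂ ℘ - g₃` becomes `4u³ - 4u² + κ² u`; division by `u⁴` gives
  -- the equation for `v = 1/u`.
  generalize hw : 1 / 3 + L.weierstrassP z = u at *
  rw [show L.weierstrassP z = u - 1 / 3 by linear_combination hw]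
  field_simp
  ring

/-- The function `2 (1 - dn₂) / κ²` solves `v'² = 4v - 4v² + κ² v³` near `0`. -/
theorem IsDnTwoData.deriv_sq {κ r : ℝ} {φ ψ : ℂ → ℂ} (h : IsDnTwoData κ r φ ψ) (hκ : κ ≠ 0) :
    ∀ᶠ z in 𝓝 (0 : ℂ), deriv (fun z ↦ 2 * (1 - dnTwo ψ z) / (κ : ℂ) ^ 2) z ^ 2 =
      4 * (2 * (1 - dnTwo ψ z) / (κ : ℂ) ^ 2) - 4 * (2 * (1 - dnTwo ψ z) / (κ : ℂ) ^ 2) ^ 2 +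
        (κ : ℂ) ^ 2 * (2 * (1 - dnTwo ψ z) / (κ : ℂ) ^ 2) ^ 3 := by
  have hκ' : (κ : ℂ) ≠ 0 := Complex.ofReal_ne_zero.2 hκ
  have hφ := h.analytic_phi 0 (Metric.mem_ball_self h.radius_pos)
  have hψ := h.analytic_psi 0 (Metric.mem_ball_self h.radius_pos)
  have hball : ∀ᶠ z in 𝓝 (0 : ℂ), z ∈ Metric.ball (0 : ℂ) r := Metric.ball_mem_nhds _ h.radius_pos
  have hF := hφ.continuousAt.eventually (by
    rw [h.phi_zero]; exact hasDerivAt_sigFourIntegral κ)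
  have hsin := hψ.continuousAt.eventually (by
    rw [h.psi_zero]; exact ordinaryHypergeometric_quarter_sin_sq)
  have hcos : ∀ᶠ z in 𝓝 (0 : ℂ), Complex.cos (ψ z) ≠ 0 :=
    (Complex.continuous_cos.continuousAt.comp hψ.continuousAt).eventually_ne (by simp [h.psi_zero])
  have hcos1 : ∀ᶠ z in 𝓝 (0 : ℂ), Complex.cos (ψ z) ≠ -1 :=
    (Complex.continuous_cos.continuousAt.comp hψ.continuousAt).eventually_ne (by
      simp [h.psi_zero]; norm_num)
  filter_upwards [hball, hball.eventually_nhds, hF, hsin, hcos, hcos1] with z hz hz' hFz hsz hcz hcz1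
  have hdφ := (h.analytic_phi z hz).differentiableAt.hasDerivAt
  have hdψ := (h.analytic_psi z hz).differentiableAt.hasDerivAt
  have e1 := (hFz.comp z hdφ).unique ((hasDerivAt_id z).congr_of_eventuallyEq
    (hz'.mono fun w hw ↦ h.right_inv w hw))
  have e2 := hdψ.csin.unique ((hdφ.csin.const_mul (κ : ℂ)).congr_of_eventuallyEq
    (hz'.mono fun w hw ↦ h.sin_psi w hw))
  have e3 := h.sin_psi z hz
  have hd : HasDerivAt (fun z ↦ 2 * (1 - dnTwo ψ z) / (κ : ℂ) ^ 2)
      (2 * (0 - -Complex.sin (ψ z) * deriv ψ z) / (κ : ℂ) ^ 2) z :=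
    (((hasDerivAt_const z 1).sub hdψ.ccos).const_mul 2).div_const _
  rw [hd.deriv]
  rw [← mul_pow, ← e3] at e1
  have sφ := Complex.sin_sq_add_cos_sq (φ z)
  have sψ := Complex.sin_sq_add_cos_sq (ψ z)
  simp only [dnTwo]
  generalize ordinaryHypergeometric (1 / 4 : ℂ) (3 / 4 : ℂ) (1 / 2 : ℂ) (Complex.sin (ψ z) ^ 2) = F
    at *
  generalize Complex.sin (ψ z) = s at *
  generalize Complex.cos (ψ z) = C at *
  generalize Complex.sin (φ z) = σ at *
  generalize Complex.cos (φ z) = γ at *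
  generalize deriv φ z = p at *
  generalize deriv ψ z = q at *
  have hC : 1 + C ≠ 0 := fun hC ↦ hcz1 (by linear_combination hC)
  -- Eliminating `F`, `φ` and `φ'` leaves `e7`, an equation for `cos ψ` alone because `(cos ψ)' = -s
  -- q`.
  have e4 : (1 + C) * p ^ 2 = 2 * C ^ 2 := by
    linear_combination -p ^ 2 * hsz + 2 * C ^ 2 * (F * p + 1) * e1
  have e5 : C ^ 2 * q ^ 2 = (κ ^ 2 - s ^ 2) * p ^ 2 := by
    linear_combination (C * q + κ * (γ * p)) * e2 + κ ^ 2 * p ^ 2 * sφ + p ^ 2 * (s + κ * σ) * e3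
  have e6 : (1 + C) * q ^ 2 = 2 * (κ ^ 2 - s ^ 2) := by
    refine mul_left_cancel₀ (pow_ne_zero 2 hcz) ?_
    linear_combination (1 + C) * e5 + (κ ^ 2 - s ^ 2) * e4
  have e7 : s ^ 2 * q ^ 2 = 2 * (1 - C) * (κ ^ 2 - 1 + C ^ 2) := by
    linear_combination q ^ 2 * sψ + (1 - C) * e6 - 2 * (1 - C) * sψ
  field_simp
  linear_combination 2 * e7

/-- Otherwise `sin φ` would vanish near `0`, giving `φ' 0 = 0` against `F φ' = 1`. This excludes the
zero solution in the uniqueness argument. -/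
theorem IsDnTwoData.not_eventually_eq_one {κ r : ℝ} {φ ψ : ℂ → ℂ} (h : IsDnTwoData κ r φ ψ)
    (hκ : κ ≠ 0) : ¬ ∀ᶠ z in 𝓝 (0 : ℂ), dnTwo ψ z = 1 := by
  intro hd
  have hκ' : (κ : ℂ) ≠ 0 := Complex.ofReal_ne_zero.2 hκ
  have hball : ∀ᶠ z in 𝓝 (0 : ℂ), z ∈ Metric.ball (0 : ℂ) r := Metric.ball_mem_nhds _ h.radius_pos
  have hdφ := (h.analytic_phi 0 (Metric.mem_ball_self h.radius_pos)).differentiableAt.hasDerivAt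
  have hz : (fun z ↦ Complex.sin (φ z)) =ᶠ[𝓝 0] fun _ ↦ 0 := by
    filter_upwards [hd, hball] with z hz hzb
    have h1 := Complex.sin_sq_add_cos_sq (ψ z)
    rw [show Complex.cos (ψ z) = 1 from hz, h.sin_psi z hzb] at h1
    have h2 : ((κ : ℂ) * Complex.sin (φ z)) ^ 2 = 0 := by linear_combination h1
    simpa [hκ'] using h2
  have e1 := hdφ.csin.unique ((hasDerivAt_const (0 : ℂ) (0 : ℂ)).congr_of_eventuallyEq hz)
  have hF := (hasDerivAt_sigFourIntegral κ).self_of_nhds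
  have e2 := (hF.comp_of_eq 0 hdφ h.phi_zero.symm).unique ((hasDerivAt_id (0 : ℂ)).congr_of_eventuallyEq
    (hball.mono fun w hw ↦ h.right_inv w hw))
  simp only [h.phi_zero, Complex.cos_zero, one_mul] at e1
  simp [e1] at e2

theorem IsDnTwoData.analyticOnNhd_dnTwo {κ r : ℝ} {φ ψ : ℂ → ℂ} (h : IsDnTwoData κ r φ ψ) :
    AnalyticOnNhd ℂ (dnTwo ψ) (Metric.ball 0 r) := fun z hz ↦ by
  have := h.analytic_psi z hz
  unfold dnTwo
  fun_prop

/-- The identity between `dn₂` and `℘` in a punctured neighbourhood of `0`. -/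
theorem IsDnTwoData.eventually_one_sub_dnTwo_mul {κ r : ℝ} {φ ψ : ℂ → ℂ} {L : PeriodPair}
    (h : IsDnTwoData κ r φ ψ) (hL : HasDnTwoInvariants κ L) (hκ₀ : κ ≠ 0) (hκ₁ : κ ^ 2 ≤ 1) :
    ∀ᶠ z in 𝓝[≠] (0 : ℂ), (1 - dnTwo ψ z) * (1 / 3 + L.weierstrassP z) = (κ : ℂ) ^ 2 / 2 := by
  have hκ' : (κ : ℂ) ≠ 0 := Complex.ofReal_ne_zero.2 hκ₀
  have hdn := h.analyticOnNhd_dnTwo 0 (Metric.mem_ball_self h.radius_pos)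
  obtain ⟨v, hv, hv0, hmul, hode⟩ := hL.exists_analyticAt_inv hκ₁
  have key := AnalyticAt.eventuallyEq_of_deriv_sq (v := v)
    (w := fun z ↦ 2 * (1 - dnTwo ψ z) / (κ : ℂ) ^ 2) hv hv0 (fun hv ↦ ?_) hode
    (by simp only [div_eq_mul_inv]; fun_prop) (by simp [dnTwo, h.psi_zero]) (fun hw ↦ ?_)
    (nhdsWithin_le_nhds (h.deriv_sq hκ₀))
  · filter_upwards [nhdsWithin_le_nhds key, hmul] with z h1 h2
    rw [h1] at h2
    field_simp at h2
    linear_combination h2 / 6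
  · obtain ⟨z, h1, h2⟩ := ((hv.filter_mono nhdsWithin_le_nhds).and hmul).exists
    simp [show v z = 0 from h1] at h2
  · refine h.not_eventually_eq_one hκ₀ (hw.mono fun z hz ↦ ?_)
    have h1 : 2 * (1 - dnTwo ψ z) / (κ : ℂ) ^ 2 = 0 := hz
    field_simp at h1
    linear_combination -h1 / 2

/-- The disc may contain nonzero lattice points, so the identity theorem is applied to meromorphic
functions; analyticity at `z` then turns the punctured identity into one at `z` itself. -/
theorem IsDnTwoData.one_sub_dnTwo_mul {κ r : ℝ} {φ ψ : ℂ → ℂ} {L : PeriodPair}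
    (h : IsDnTwoData κ r φ ψ) (hL : HasDnTwoInvariants κ L) (hκ₀ : κ ≠ 0) (hκ₁ : κ ^ 2 ≤ 1)
    {z : ℂ} (hz : z ∈ Metric.ball (0 : ℂ) r) (hzL : z ∉ L.lattice) :
    (1 - dnTwo ψ z) * (1 / 3 + L.weierstrassP z) = (κ : ℂ) ^ 2 / 2 := by
  set q : ℂ → ℂ := fun z ↦ (1 - dnTwo ψ z) * (1 / 3 + L.weierstrassP z) - (κ : ℂ) ^ 2 / 2 with hq
  have hmer : MeromorphicOn q (Metric.ball 0 r) := fun w hw ↦ by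
    have h1 := (h.analyticOnNhd_dnTwo w hw).meromorphicAt
    have h2 := L.meromorphic_weierstrassP w
    fun_prop
  have hconn : IsConnected (Metric.ball (0 : ℂ) r) :=
    ⟨⟨0, Metric.mem_ball_self h.radius_pos⟩, (convex_ball 0 r).isPreconnected⟩
  have htop : meromorphicOrderAt q z = ⊤ := by
    by_contra hne
    refine (hmer.exists_meromorphicOrderAt_ne_top_iff_forall_mem hconn).1 ⟨z, hz, hne⟩ 0
      (Metric.mem_ball_self h.radius_pos) (meromorphicOrderAt_eq_top_iff.2 ?_)
    filter_upwards [h.eventually_one_sub_dnTwo_mul hL hκ₀ hκ₁] with w hw using sub_eq_zero.2 hw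
  have han : AnalyticAt ℂ q z := by
    have h1 := h.analyticOnNhd_dnTwo z hz
    have h2 := L.analyticOnNhd_weierstrassP z hzL
    fun_prop
  have hzero : q =ᶠ[𝓝 z] fun _ ↦ 0 := han.frequently_eq_iff_eventually_eq analyticAt_const |>.1
    (meromorphicOrderAt_eq_top_iff.1 htop).frequently
  exact sub_eq_zero.1 hzero.self_of_nhds

/-! ### The global elliptic extension -/

/-- The elliptic function `1 - (κ² / 2) / (1/3 + ℘)`, in normal form. -/
noncomputable def ellipticDnTwo (κ : ℝ) (L : PeriodPair) : ℂ → ℂ :=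
  toMeromorphicNFOn (fun z ↦ 1 - (κ : ℂ) ^ 2 / 2 / (1 / 3 + L.weierstrassP z)) Set.univ

theorem meromorphicOn_ellipticDnTwo_formula (κ : ℝ) (L : PeriodPair) :
    MeromorphicOn (fun z ↦ 1 - (κ : ℂ) ^ 2 / 2 / (1 / 3 + L.weierstrassP z)) Set.univ :=
  fun z _ ↦ by
    have := L.meromorphic_weierstrassP z
    fun_prop

theorem ellipticDnTwo_eventuallyEq (κ : ℝ) (L : PeriodPair) (z : ℂ) :
    ellipticDnTwo κ L =ᶠ[𝓝[≠] z] fun z ↦ 1 - (κ : ℂ) ^ 2 / 2 / (1 / 3 + L.weierstrassP z) :=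
  (meromorphicOn_ellipticDnTwo_formula κ L).toMeromorphicNFOn_eq_self_on_nhdsNE (Set.mem_univ z)

/-- Functions in meromorphic normal form that agree on a punctured neighbourhood also agree at its
centre. -/
theorem ellipticDnTwo_eq_of_analyticAt {κ : ℝ} {L : PeriodPair} {f : ℂ → ℂ} {z : ℂ}
    (hf : AnalyticAt ℂ f z)
    (h : ∀ᶠ w in 𝓝[≠] z, f w = 1 - (κ : ℂ) ^ 2 / 2 / (1 / 3 + L.weierstrassP w)) :
    ellipticDnTwo κ L z = f z :=
  (((meromorphicNFOn_toMeromorphicNFOn _ _ (Set.mem_univ z)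
    ).eventuallyEq_nhdsNE_iff_eventuallyEq_nhds hf.meromorphicNFAt).1
      ((ellipticDnTwo_eventuallyEq κ L z).trans (EventuallyEq.symm h))).self_of_nhds

theorem isEllipticFor_ellipticDnTwo (κ : ℝ) (L : PeriodPair) :
    IsEllipticFor L (ellipticDnTwo κ L) := by
  have hNF : MeromorphicNFOn (ellipticDnTwo κ L) Set.univ := meromorphicNFOn_toMeromorphicNFOn _ _
  refine ⟨hNF, fun w hw z ↦ ?_⟩
  have hshift : MeromorphicNFAt (ellipticDnTwo κ L ∘ (· + w)) z :=
    meromorphicNFAt_comp_add_const_iff_meromorphicNFAt.2 (hNF (Set.mem_univ _))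
  have htend : Tendsto (· + w) (𝓝[≠] z) (𝓝[≠] (z + w)) :=
    tendsto_nhdsWithin_iff.2 ⟨((continuous_add_const w).tendsto z).mono_left nhdsWithin_le_nhds,
      eventually_mem_nhdsWithin.mono fun y hy ↦ by simpa using hy⟩
  -- The translate is again in normal form, so periodicity off the exceptional points suffices.
  refine ((hshift.eventuallyEq_nhdsNE_iff_eventuallyEq_nhds (hNF (Set.mem_univ z))).1
    ?_).self_of_nhds
  filter_upwards [htend.eventually (ellipticDnTwo_eventuallyEq κ L (z + w)),
    ellipticDnTwo_eventuallyEq κ L z] with y h1 h2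
  rw [Function.comp_apply, h1, h2, L.weierstrassP_add_coe y ⟨w, hw⟩]

theorem IsDnTwoData.eqOn_ellipticDnTwo {κ r : ℝ} {φ ψ : ℂ → ℂ} {L : PeriodPair}
    (h : IsDnTwoData κ r φ ψ) (hL : HasDnTwoInvariants κ L) (hκ₀ : κ ≠ 0) (hκ₁ : κ ^ 2 ≤ 1) :
    Set.EqOn (ellipticDnTwo κ L) (dnTwo ψ) (Metric.ball 0 r) := by
  intro z hz
  refine ellipticDnTwo_eq_of_analyticAt (h.analyticOnNhd_dnTwo z hz) ?_
  filter_upwards [L.eventually_notMem_lattice z,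
    nhdsWithin_le_nhds (Metric.isOpen_ball.mem_nhds hz)] with w hwL hw
  have h1 := h.one_sub_dnTwo_mul hL hκ₀ hκ₁ hw hwL
  have hκ' : (κ : ℂ) ^ 2 / 2 ≠ 0 := by simpa using hκ₀
  have hu : 1 / 3 + L.weierstrassP w ≠ 0 := right_ne_zero_of_mul (h1.trans_ne hκ')
  rw [← h1, mul_div_cancel_right₀ _ hu, sub_sub_cancel]

theorem one_sub_ellipticDnTwo_mul (κ : ℝ) {L : PeriodPair} {z : ℂ} (hz : z ∉ L.lattice)
    (hu : 1 / 3 + L.weierstrassP z ≠ 0) :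
    (1 - ellipticDnTwo κ L z) * (1 / 3 + L.weierstrassP z) = (κ : ℂ) ^ 2 / 2 := by
  have h1 := L.analyticOnNhd_weierstrassP z hz
  rw [ellipticDnTwo_eq_of_analyticAt
    (f := fun z ↦ 1 - (κ : ℂ) ^ 2 / 2 / (1 / 3 + L.weierstrassP z))
    (analyticAt_const.sub (analyticAt_const.div (analyticAt_const.add h1) hu))
    (Eventually.of_forall fun _ ↦ rfl), sub_sub_cancel, div_mul_cancel₀ _ hu]

end

/-! ### Lattices with prescribed real invariants -/

section

open PeriodPair UpperHalfPlane EisensteinSeries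

theorem PeriodPair.G_of_smul_lattice {L L' : PeriodPair} {c : ℂ} (hc : c ≠ 0)
    (h : ∀ x, c * x ∈ L'.lattice ↔ x ∈ L.lattice) (n : ℕ) : L'.G n = (c ^ n)⁻¹ * L.G n := by
  let e : L.lattice ≃ L'.lattice :=
    { toFun := fun x ↦ ⟨c * x, (h x).2 x.2⟩
      invFun := fun y ↦ ⟨c⁻¹ * y, (h _).1 (by rw [mul_inv_cancel_left₀ hc]; exact y.2)⟩
      left_inv := fun x ↦ by ext; simp [hc]
      right_inv := fun y ↦ by ext; simp [hc] }
  rw [PeriodPair.G, PeriodPair.G, ← e.tsum_eq, ← tsum_mul_left]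
  refine tsum_congr fun x ↦ ?_
  simp [e, mul_pow, mul_comm]

/-- The period pair `(c ω₁, c ω₂)`. -/
noncomputable def PeriodPair.scale (L : PeriodPair) (c : ℂ) (hc : c ≠ 0) : PeriodPair where
  ω₁ := c * L.ω₁
  ω₂ := c * L.ω₂
  indep := by
    rw [LinearIndependent.pair_iff]
    intro s t hst
    refine LinearIndependent.pair_iff.1 L.indep s t (mul_left_cancel₀ hc ?_)
    rw [mul_zero, ← hst]
    simp only [Complex.real_smul]
    ring

theorem PeriodPair.G_scale (L : PeriodPair) {c : ℂ} (hc : c ≠ 0) (n : ℕ) :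
    (L.scale c hc).G n = (c ^ n)⁻¹ * L.G n := by
  refine G_of_smul_lattice hc (fun x ↦ ?_) n
  simp only [PeriodPair.mem_lattice, scale]
  refine exists₂_congr fun m n ↦ ?_
  rw [← mul_right_inj' hc (b := m * L.ω₁ + n * L.ω₂)]
  ring_nf

/-- The period pair `(τ, 1)` for `τ` in the upper half-plane. -/
noncomputable def PeriodPair.ofUpperHalfPlane (τ : ℍ) : PeriodPair where
  ω₁ := τ
  ω₂ := 1
  indep := by
    rw [LinearIndependent.pair_iff]
    intro s t hst
    have h1 : s = 0 := by simpa [τ.im_ne_zero] using congrArg Complex.im hst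
    subst h1
    simpa using hst

theorem PeriodPair.G_ofUpperHalfPlane (τ : ℍ) (k : ℕ) :
    (ofUpperHalfPlane τ).G k = ∑' v, eisSummand k v τ := by
  rw [PeriodPair.G, ← (ofUpperHalfPlane τ).latticeEquivProd.symm.toEquiv.tsum_eq,
    ← (finTwoArrowEquiv ℤ).tsum_eq]
  refine tsum_congr fun v ↦ ?_
  have := (ofUpperHalfPlane τ).latticeEquiv_symm_apply (v 0, v 1)
  rw [LinearEquiv.coe_toEquiv, show finTwoArrowEquiv ℤ v = (v 0, v 1) from rfl, this]
  simp [ofUpperHalfPlane, eisSummand]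

/-- Multiplication by `i` preserves the Gaussian lattice, and `i ^ 6 = -1`. -/
theorem PeriodPair.G_six_ofUpperHalfPlane_I : (ofUpperHalfPlane I).G 6 = 0 := by
  have h := G_of_smul_lattice (L := ofUpperHalfPlane I) (L' := ofUpperHalfPlane I)
    (c := Complex.I) Complex.I_ne_zero (fun x ↦ ?_) 6
  · have h6 : Complex.I ^ 6 = -1 := by rw [show 6 = 2 * 3 by rfl, pow_mul, Complex.I_sq]; norm_num
    rw [h6] at h
    linear_combination h / 2
  · simp only [PeriodPair.mem_lattice, ofUpperHalfPlane, UpperHalfPlane.coe_I, mul_one]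
    constructor
    · rintro ⟨m, n, h⟩
      refine ⟨-n, m, ?_⟩
      push_cast
      linear_combination -Complex.I * h + (m - x) * Complex.I_mul_I
    · rintro ⟨m, n, rfl⟩
      refine ⟨n, -m, ?_⟩
      push_cast
      linear_combination -m * Complex.I_mul_I

theorem riemannZeta_six : riemannZeta 6 = (Real.pi : ℂ) ^ 6 / 945 := by
  have h := riemannZeta_two_mul_nat (k := 3) (by norm_num)
  have hb : bernoulli 6 = 1 / 42 := by
    rw [bernoulli_eq_bernoulli'_of_ne_one (by norm_num), bernoulli'_def]
    have h1 : Nat.choose 6 2 = 15 := by decide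
    have h2 : Nat.choose 6 4 = 15 := by decide
    norm_num [Finset.sum_range_succ, h1, h2, bernoulli'_eq_zero_of_odd (n := 5) (by decide)]
  norm_num [hb, Nat.factorial] at h
  rw [h]
  ring

/-- The Lambert series `∑ σₖ(n) xⁿ` over `n ≥ 1`. -/
noncomputable def sigmaSeries (k : ℕ) (x : ℝ) : ℝ := ∑' n : ℕ+, (ArithmeticFunction.sigma k n : ℝ) * x ^ (n : ℕ)

theorem sigmaSeries_zero (k : ℕ) : sigmaSeries k 0 = 0 := by
  simp [sigmaSeries]

theorem sigmaSeries_nonneg (k : ℕ) {x : ℝ} (hx : 0 ≤ x) : 0 ≤ sigmaSeries k x :=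
  tsum_nonneg fun _ ↦ by positivity

/-- The bound `σₖ(n) ≤ n^(k+1)` gives a uniform summable majorant on `[0, r]`. -/
theorem continuousOn_sigmaSeries (k : ℕ) {r : ℝ} (hr0 : 0 ≤ r) (hr : r < 1) :
    ContinuousOn (sigmaSeries k) (Set.Icc 0 r) := by
  have hs : Summable fun n : ℕ ↦ (n : ℝ) ^ (k + 1) * r ^ n :=
    summable_pow_mul_geometric_of_norm_lt_one _ (by rwa [Real.norm_of_nonneg hr0])
  refine continuousOn_tsum (fun n ↦ by fun_prop) (hs.comp_injective PNat.coe_injective)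
    fun n x hx ↦ ?_
  have h0 := hx.1
  rw [Real.norm_of_nonneg (by positivity)]
  simp only [Function.comp]
  gcongr
  · exact_mod_cast ArithmeticFunction.sigma_le_pow_succ k n
  · exact hx.2

/-- The point `τ` of the imaginary axis with `exp(2πiτ) = q`. -/
noncomputable def nomePoint (q : ℝ) (h0 : 0 < q) (h1 : q < 1) : ℍ :=
  ⟨Complex.I * ((-Real.log q / (2 * Real.pi) : ℝ) : ℂ), by
    have := Real.log_neg h0 h1
    have := Real.pi_pos
    rw [Complex.I_mul_im, Complex.ofReal_re]
    exact div_pos (by linarith) (by linarith)⟩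

theorem cexp_nomePoint {q : ℝ} (h0 : 0 < q) (h1 : q < 1) :
    Complex.exp (2 * Real.pi * Complex.I * (nomePoint q h0 h1 : ℂ)) = q := by
  have hpi : (Real.pi : ℂ) ≠ 0 := Complex.ofReal_ne_zero.2 Real.pi_ne_zero
  have : 2 * Real.pi * Complex.I * (nomePoint q h0 h1 : ℂ) = (Real.log q : ℂ) := by
    simp only [nomePoint, UpperHalfPlane.coe_mk]
    push_cast
    field_simp
    linear_combination -(Real.log q : ℂ) * Complex.I_sq
  rw [this, ← Complex.ofReal_exp, Real.exp_log h0]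

theorem nomePoint_exp_neg_two_pi (h0 : 0 < Real.exp (-(2 * Real.pi)))
    (h1 : Real.exp (-(2 * Real.pi)) < 1) : nomePoint _ h0 h1 = I := by
  apply UpperHalfPlane.ext
  have hpi : (Real.pi : ℂ) ≠ 0 := Complex.ofReal_ne_zero.2 Real.pi_ne_zero
  simp only [nomePoint, UpperHalfPlane.coe_mk, UpperHalfPlane.coe_I, Real.log_exp]
  push_cast
  field_simp

theorem PeriodPair.G_nomePoint {q : ℝ} (h0 : 0 < q) (h1 : q < 1) {k : ℕ} (hk : 3 ≤ k)
    (hk2 : Even k) : (ofUpperHalfPlane (nomePoint q h0 h1)).G k = 2 * riemannZeta k +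
      2 * ((-2 * Real.pi * Complex.I) ^ k / (k - 1).factorial) * sigmaSeries (k - 1) q := by
  rw [G_ofUpperHalfPlane, tsum_eisSummand_eq_tsum_sigma_mul_cexp_pow hk hk2, cexp_nomePoint,
    sigmaSeries, Complex.ofReal_tsum]
  push_cast
  rfl

theorem PeriodPair.g₂_nomePoint {q : ℝ} (h0 : 0 < q) (h1 : q < 1) :
    (ofUpperHalfPlane (nomePoint q h0 h1)).g₂ =
      (4 * Real.pi ^ 4 / 3 * (1 + 240 * sigmaSeries 3 q) : ℝ) := by
  have h4 : (-2 * Real.pi * Complex.I) ^ 4 = 16 * (Real.pi : ℂ) ^ 4 := by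
    linear_combination (16 * (Real.pi : ℂ) ^ 4 * (Complex.I ^ 2 - 1)) * Complex.I_sq
  rw [PeriodPair.g₂, G_nomePoint h0 h1 (by norm_num) (by decide), h4]
  norm_num [riemannZeta_four, Nat.factorial]
  ring

theorem PeriodPair.g₃_nomePoint {q : ℝ} (h0 : 0 < q) (h1 : q < 1) :
    (ofUpperHalfPlane (nomePoint q h0 h1)).g₃ =
      (8 * Real.pi ^ 6 / 27 * (1 - 504 * sigmaSeries 5 q) : ℝ) := by
  have h6 : (-2 * Real.pi * Complex.I) ^ 6 = -64 * (Real.pi : ℂ) ^ 6 := by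
    linear_combination (64 * (Real.pi : ℂ) ^ 6 * (Complex.I ^ 4 - Complex.I ^ 2 + 1)) * Complex.I_sq
  rw [PeriodPair.g₃, G_nomePoint h0 h1 (by norm_num) (by decide), h6]
  norm_num [riemannZeta_six, Nat.factorial]
  ring

/-- Real numbers `a > 0` and `b` with `a³ > 27 b²` are the invariants of a lattice. -/
theorem PeriodPair.exists_g₂_g₃_eq {a b : ℝ} (ha : 0 < a) (hab : 27 * b ^ 2 < a ^ 3) :
    ∃ L : PeriodPair, L.g₂ = a ∧ L.g₃ = b := by
  have hpi := Real.pi_pos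
  have hq0 : 0 < Real.exp (-(2 * Real.pi)) := Real.exp_pos _
  have hq1 : Real.exp (-(2 * Real.pi)) < 1 := Real.exp_lt_one_iff.2 (by linarith)
  have hend := g₃_nomePoint hq0 hq1
  rw [nomePoint_exp_neg_two_pi, PeriodPair.g₃, G_six_ofUpperHalfPlane_I, mul_zero, eq_comm,
    Complex.ofReal_eq_zero] at hend
  let A : ℝ → ℝ := fun q ↦ 4 * Real.pi ^ 4 / 3 * (1 + 240 * sigmaSeries 3 q)
  let B : ℝ → ℝ := fun q ↦ 8 * Real.pi ^ 6 / 27 * (1 - 504 * sigmaSeries 5 q)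
  have hApos {q : ℝ} (hq : 0 ≤ q) : 0 < A q := by
    have := sigmaSeries_nonneg 3 hq
    positivity
  -- A zero means that `(A, B)` matches `(a, b)` up to scaling and the sign of `b`. At `q = 0`,
  -- where `A³ = 27 B²`, the function is negative; at `q = exp (-2π)`, where `τ = i` and `B = 0`, it
  -- is nonnegative.
  have hcont : ContinuousOn (fun q ↦ A q ^ 3 * b ^ 2 - a ^ 3 * B q ^ 2)
      (Set.Icc 0 (Real.exp (-(2 * Real.pi)))) := by
    have h3 := continuousOn_sigmaSeries 3 hq0.le hq1
    have h5 := continuousOn_sigmaSeries 5 hq0.le hq1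
    fun_prop
  have hzero : A 0 ^ 3 * b ^ 2 - a ^ 3 * B 0 ^ 2 < 0 := by
    have : A 0 ^ 3 * b ^ 2 - a ^ 3 * B 0 ^ 2 =
        -(64 * Real.pi ^ 12 / 729 * (a ^ 3 - 27 * b ^ 2)) := by
      simp only [A, B, sigmaSeries_zero]
      ring
    rw [this, neg_lt_zero]
    exact mul_pos (by positivity) (by linarith)
  obtain ⟨q, hq, hH⟩ := intermediate_value_Icc hq0.le hcont
    (show (0 : ℝ) ∈ _ from ⟨hzero.le, by
      have := hApos hq0.le
      have hB : B (Real.exp (-(2 * Real.pi))) = 0 := hend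
      simp only [hB]
      have := mul_nonneg (pow_pos this 3).le (sq_nonneg b)
      linarith⟩)
  have hqpos : 0 < q := by
    refine hq.1.lt_of_ne ?_
    rintro rfl
    exact hzero.ne hH
  have hqlt : q < 1 := hq.2.trans_lt hq1
  have hA := hApos hq.1
  obtain ⟨c, hc, hc4⟩ : ∃ c : ℝ, 0 < c ∧ c ^ 4 = A q / a :=
    ⟨(A q / a) ^ ((4 : ℕ) : ℝ)⁻¹, by positivity,
      Real.rpow_inv_natCast_pow (by positivity) (by norm_num)⟩
  have hcC : (c : ℂ) ≠ 0 := Complex.ofReal_ne_zero.2 hc.ne'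
  set L := ofUpperHalfPlane (nomePoint q hqpos hqlt) with hL
  have hg2 : ((c ^ 4 : ℝ) : ℂ)⁻¹ * L.g₂ = a := by
    rw [hL, g₂_nomePoint, ← Complex.ofReal_inv, ← Complex.ofReal_mul, hc4]
    congr 1
    change (A q / a)⁻¹ * A q = a
    field_simp
  have hsq : ((c ^ 6)⁻¹ * B q) ^ 2 = b ^ 2 := by
    have : (c ^ 6) ^ 2 = A q ^ 3 / a ^ 3 := by rw [← div_pow, ← hc4]; ring
    rw [mul_pow, inv_pow, this, inv_div]
    field_simp
    linarith
  have hg3 : ((c ^ 6 : ℝ) : ℂ)⁻¹ * L.g₃ = ((c ^ 6)⁻¹ * B q : ℝ) := by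
    rw [hL, g₃_nomePoint]
    push_cast [B]
    rfl
  rcases sq_eq_sq_iff_eq_or_eq_neg.1 hsq with h | h
  · refine ⟨L.scale c hcC, ?_, ?_⟩
    · rw [← hg2, PeriodPair.g₂, G_scale, PeriodPair.g₂]
      push_cast
      ring
    · rw [← h, ← hg3, PeriodPair.g₃, G_scale, PeriodPair.g₃]
      push_cast
      ring
  -- The extra factor `i` keeps `g₂` and flips the sign of `g₃`.
  · refine ⟨L.scale (Complex.I * c) (mul_ne_zero Complex.I_ne_zero hcC), ?_, ?_⟩
    · rw [← hg2, PeriodPair.g₂, G_scale, PeriodPair.g₂, mul_pow, Complex.I_pow_four]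
      push_cast
      ring
    · have h6 : Complex.I ^ 6 = -1 := by
        rw [show 6 = 2 * 3 by rfl, pow_mul, Complex.I_sq]
        norm_num
      rw [neg_eq_iff_eq_neg.1 h.symm, Complex.ofReal_neg, ← hg3, PeriodPair.g₃, G_scale,
        PeriodPair.g₃, mul_pow, h6]
      push_cast
      ring

theorem exists_hasDnTwoInvariants {κ : ℝ} (hκ₀ : 0 < κ) (hκ₁ : κ < 1) :
    ∃ L : PeriodPair, HasDnTwoInvariants κ L := by
  have h1 : κ ^ 2 < 1 := by nlinarith
  have hl : complementaryModulus κ ^ 2 = 1 - κ ^ 2 := Real.sq_sqrt (by linarith)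
  obtain ⟨L, h2, h3⟩ := PeriodPair.exists_g₂_g₃_eq (a := complementaryModulus κ ^ 2 + 1 / 3)
    (b := complementaryModulus κ ^ 2 / 3 - 1 / 27) (by positivity) (by
      rw [hl]
      -- This is exactly `g₂³ - 27 g₃²`.
      have : 0 < (κ ^ 2) ^ 2 * (1 - κ ^ 2) := mul_pos (by positivity) (by linarith)
      linarith)
  refine ⟨L, ?_, ?_⟩
  · rw [h2]
    push_cast
    rfl
  · rw [h3]
    push_cast
    rfl

end

theorem mainTheorem4 (κ : ℝ) (hκ₀ : 0 < κ) (hκ₁ : κ < 1) :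
    -- the local construction of `dn₂` is possible
    (∃ (r : ℝ) (φ ψ : ℂ → ℂ), IsDnTwoData κ r φ ψ) ∧
    -- the Weierstrass function with the stated invariants exists
    (∃ L : PeriodPair, HasDnTwoInvariants κ L) ∧
    -- the two forms of the invariants agree
    complementaryModulus κ ^ 2 + 1 / 3 = 4 / 3 - κ ^ 2 ∧
    complementaryModulus κ ^ 2 / 3 - 1 / 27 = 8 / 27 - κ ^ 2 / 3 ∧
    ∀ L : PeriodPair, HasDnTwoInvariants κ L →
      -- the identity in the disc of definition, away from the poles of `℘`
      (∀ (r : ℝ) (φ ψ : ℂ → ℂ), IsDnTwoData κ r φ ψ →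
        ∀ z ∈ Metric.ball (0 : ℂ) r, z ∉ L.lattice →
          (1 - dnTwo ψ z) * (1 / 3 + L.weierstrassP z) = (κ : ℂ) ^ 2 / 2) ∧
      -- the extension to an elliptic function, for which the identity holds globally
      ∃ g : ℂ → ℂ, IsEllipticFor L g ∧
        (∀ (r : ℝ) (φ ψ : ℂ → ℂ), IsDnTwoData κ r φ ψ →
          Set.EqOn g (dnTwo ψ) (Metric.ball 0 r)) ∧
        ∀ z : ℂ, z ∉ L.lattice → 1 / 3 + L.weierstrassP z ≠ 0 →
          (1 - g z) * (1 / 3 + L.weierstrassP z) = (κ : ℂ) ^ 2 / 2 := by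
  have hsq : κ ^ 2 ≤ 1 := pow_le_one₀ hκ₀.le hκ₁.le
  have hl : complementaryModulus κ ^ 2 = 1 - κ ^ 2 := Real.sq_sqrt (by linarith)
  refine ⟨exists_isDnTwoData κ, exists_hasDnTwoInvariants hκ₀ hκ₁, by rw [hl]; ring,
    by rw [hl]; ring, fun L hL ↦ ⟨fun r φ ψ h z hz hzL ↦
      h.one_sub_dnTwo_mul hL hκ₀.ne' hsq hz hzL, ellipticDnTwo κ L,
      isEllipticFor_ellipticDnTwo κ L, fun r φ ψ h ↦ h.eqOn_ellipticDnTwo hL hκ₀.ne' hsq,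
      fun z hz hu ↦ one_sub_ellipticDnTwo_mul κ hz hu⟩⟩
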